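/- Let $G$ be a group and let $\psi$ be an automorphism of $G$. Elements $x,y\in G$ are called $\psi$-conjugate if $x=zy\psi(z)^{-1}$ for some $z\in G$. This is an equivalence relation, and the Reidemeister number $R(\psi)$ is the number of its classes (a positive integer or $\infty$). For a field $F$ and an even integer $n\ge 2$ let $$\Omega=\underbrace{J\oplus\dots\oplus J}_{n/2},\qquad J=\begin{pmatrix}0&1\\-1&0\end{pmatrix},\qquad \mathrm{Sp}_n(F)=\{A\in \mathrm{GL}_n(F)\mid A\Omega A^T=\Omega\}.$$ Every automorphism $\varphi$ of $F$ induces an automorphism $\varphi_n$ of the group $\mathrm{Sp}_n(F)$ by $\varphi_n((a_{i,j}))=(\varphi(a_{i,j}))$. **Theorem.** Let $F$ be an algebraically closed field of characteristic zero with infinite transcendence degree over $\mathbb{Q}$, and let $n\ge 2$ be an even integer. Then there exists an automorphism $\varphi$ of the field $F$ such that the induced automorphism $\varphi_n$ of $\mathrm{Sp}_n(F)$ satisfies $R(\varphi_n)=1$. -/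

import Mathlib

open scoped Matrix

/-- Two elements `x`, `y` of a group are twisted conjugate with respect to an automorphism `φ`
if `x = z * y * φ(z)⁻¹` for some `z` in the group. -/
def IsTwistedConj {G : Type*} [Group G] (φ : G ≃* G) (x y : G) : Prop :=
  ∃ z : G, x = z * y * (φ z)⁻¹

/-- Twisted conjugacy is an equivalence relation. -/
def twistedConjSetoid {G : Type*} [Group G] (φ : G ≃* G) : Setoid G where
  r := IsTwistedConj φ
  iseqv :=
    { refl := fun x => ⟨1, by simp⟩
      symm := by
        rintro x y ⟨z, rfl⟩
        exact ⟨z⁻¹, by simp [mul_assoc]⟩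
      trans := by
        rintro x y w ⟨z, rfl⟩ ⟨t, rfl⟩
        exact ⟨z * t, by simp [mul_assoc]⟩ }

/-- The Reidemeister number of `φ`: the number of twisted conjugacy classes, with all infinite
cardinalities identified with `⊤`. -/
noncomputable def reidemeisterNumber {G : Type*} [Group G] (φ : G ≃* G) : ℕ∞ :=
  ENat.card (Quotient (twistedConjSetoid φ))

/-- The `2m × 2m` matrix `Ω = J ⊕ ⋯ ⊕ J` (`m` summands) with `J = (0 1; -1 0)`. The index `(a, k)`
stands for the `a`-th position in the `k`-th block. -/
def symplecticForm (m : ℕ) (F : Type*) [Field F] : Matrix (Fin 2 × Fin m) (Fin 2 × Fin m) F :=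
  Matrix.blockDiagonal fun _ : Fin m => !![0, 1; -1, 0]

/-- The symplectic group `Sp_{2m}(F) = {A ∈ GL_{2m}(F) | A Ω Aᵀ = Ω}`. -/
def Sp (m : ℕ) (F : Type*) [Field F] : Subgroup (GL (Fin 2 × Fin m) F) where
  carrier := {A | (A : Matrix (Fin 2 × Fin m) (Fin 2 × Fin m) F) * symplecticForm m F *
    (A : Matrix (Fin 2 × Fin m) (Fin 2 × Fin m) F)ᵀ = symplecticForm m F}
  one_mem' := by simp
  mul_mem' := by
    intro A B hA hB
    simp only [Set.mem_ofPred_eq, Units.val_mul, Matrix.transpose_mul] at hA hB ⊢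
    calc _ = A.1 * (B.1 * symplecticForm m F * B.1ᵀ) * A.1ᵀ := by simp only [Matrix.mul_assoc]
      _ = _ := by rw [hB, hA]
  inv_mem' := by
    intro A hA
    simp only [Set.mem_ofPred_eq] at hA ⊢
    have h1 : (A⁻¹).1 * A.1 = 1 := A.inv_mul
    have h2 : A.1ᵀ * (A⁻¹).1ᵀ = 1 := by
      rw [← Matrix.transpose_mul, h1, Matrix.transpose_one]
    calc (A⁻¹).1 * symplecticForm m F * (A⁻¹).1ᵀ
        = (A⁻¹).1 * (A.1 * symplecticForm m F * A.1ᵀ) * (A⁻¹).1ᵀ := by rw [hA]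
      _ = ((A⁻¹).1 * A.1) * symplecticForm m F * (A.1ᵀ * (A⁻¹).1ᵀ) := by
        simp only [Matrix.mul_assoc]
      _ = symplecticForm m F := by rw [h1, h2, Matrix.one_mul, Matrix.mul_one]

theorem Sp.map_mem {m : ℕ} {F : Type*} [Field F] (φ : F ≃+* F) {A : GL (Fin 2 × Fin m) F}
    (hA : A ∈ Sp m F) : Matrix.GeneralLinearGroup.map φ.toRingHom A ∈ Sp m F := by
  have hA' : A.1 * symplecticForm m F * A.1ᵀ = symplecticForm m F := hA
  have hΩ : (symplecticForm m F).map φ.toRingHom = symplecticForm m F := by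
    ext ⟨a, k⟩ ⟨b, l⟩
    fin_cases a <;> fin_cases b <;>
      by_cases h : k = l <;> simp [symplecticForm, Matrix.blockDiagonal_apply, h]
  have h := congrArg (fun M => M.map φ.toRingHom) hA'
  simp only [Matrix.map_mul, Matrix.transpose_map, hΩ] at h
  exact h

/-- The automorphism of `Sp_{2m}(F)` induced by a field automorphism `φ`: it applies `φ` to every
entry of a matrix. -/
noncomputable def Sp.inducedAut (m : ℕ) {F : Type*} [Field F] (φ : F ≃+* F) :
    Sp m F ≃* Sp m F where
  toFun A := ⟨Matrix.GeneralLinearGroup.map φ.toRingHom A.1, Sp.map_mem φ A.2⟩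
  invFun A := ⟨Matrix.GeneralLinearGroup.map φ.symm.toRingHom A.1, Sp.map_mem φ.symm A.2⟩
  left_inv A := by
    ext i j
    simp
  right_inv A := by
    ext i j
    simp
  map_mul' A B := by
    ext i j
    simp

/-! `R(φ_n) = 1` means that every symplectic `A` is `W * φ(W)⁻¹` with `W` symplectic, a statement of
Lang type.

Solving in `GL`: for each invertible `A` over a field `K` with automorphism `σ`, adjoin a matrix
`X_A` of independent variables and extend `σ` by `X_A ↦ A⁻¹ X_A`; then `A * σ(X_A) = X_A`. Passing
to the algebraic closure and repeating countably often (`exists_isAlgClosed_solvesGL`) solves every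
such equation without raising the cardinality. Starting from `F`, the limit has the same
transcendence degree as `F`, since on both sides it equals the cardinality; by Steinitz the limit is
isomorphic to `F` and its automorphism is transported (`exists_solvesGL`).

Descending to `Sp` (`exists_symplectic_solution`): if `A * φ(Z) = Z`, the form `Z⁻¹ Ω Z⁻ᵀ` is fixed
by `φ`. Nondegenerate alternating forms of a given dimension are equivalent over any field, so a
matrix over the fixed field brings it back to `Ω` and corrects `Z`. -/

/-! ### Generic matrices and one extension step. -/

section GenericMatrix

variable {ι K : Type*} [Fintype ι] [DecidableEq ι] [Field K]

/-- The generic `ι × ι` matrix attached to an invertible matrix `A` over `K`; the generic matrices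
of different `A` have disjoint sets of entries. -/
noncomputable def genericMatrix (A : GL ι K) :
    Matrix ι ι (MvPolynomial (GL ι K × ι × ι) K) :=
  Matrix.of fun i j => MvPolynomial.X (A, i, j)

/-- The `K`-algebra endomorphism that multiplies the generic matrix of `A` by `u A` on the left. -/
noncomputable def genericTranslate (u : GL ι K → Matrix ι ι K) :
    MvPolynomial (GL ι K × ι × ι) K →ₐ[K] MvPolynomial (GL ι K × ι × ι) K :=
  MvPolynomial.aeval fun p =>
    ((u p.1).map MvPolynomial.C * genericMatrix p.1 : Matrix ι ι (MvPolynomial _ K)) p.2.1 p.2.2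

theorem map_genericTranslate_genericMatrix (u : GL ι K → Matrix ι ι K) (A : GL ι K) :
    (genericMatrix A).map (genericTranslate u) = (u A).map MvPolynomial.C * genericMatrix A := by
  ext1 i j
  simp [genericMatrix, genericTranslate]

/-- Substitution reverses the order: translating by `v`, then applying the `u`-translation, gives `v
A * u A * X`, because the coefficients of `v A` are fixed. -/
theorem genericTranslate_comp {u v : GL ι K → Matrix ι ι K} (h : ∀ A, v A * u A = 1) :
    (genericTranslate u).comp (genericTranslate v) = AlgHom.id K _ := by
  ext1 ⟨A, i, j⟩
  have hC : ((v A).map MvPolynomial.C).map (genericTranslate u) =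
      (v A).map (MvPolynomial.C (σ := GL ι K × ι × ι)) := by
    ext1 k l
    rw [Matrix.map_apply, Matrix.map_apply, ← MvPolynomial.algebraMap_eq, AlgHom.commutes]
  have key : ((genericMatrix A).map (genericTranslate v)).map (genericTranslate u) =
      genericMatrix A := by
    rw [map_genericTranslate_genericMatrix, Matrix.map_mul, hC,
      map_genericTranslate_genericMatrix, ← Matrix.mul_assoc, ← Matrix.map_mul, h,
      Matrix.map_one _ (map_zero _) (map_one _), Matrix.one_mul]
  simpa [genericMatrix] using congrFun (congrFun key i) j

/-- The automorphism of the polynomial ring in the entries of all generic matrices which acts on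
the coefficients by `σ` and multiplies the generic matrix of `A` by `A⁻¹`. -/
noncomputable def genericAut (σ : K ≃+* K) :
    MvPolynomial (GL ι K × ι × ι) K ≃+* MvPolynomial (GL ι K × ι × ι) K :=
  (MvPolynomial.mapEquiv _ σ).trans (AlgEquiv.ofAlgHom (genericTranslate fun A => (A⁻¹).1)
    (genericTranslate fun A => A.1) (genericTranslate_comp fun A => A.mul_inv)
    (genericTranslate_comp fun A => A.inv_mul)).toRingEquiv

theorem genericAut_C (σ : K ≃+* K) (x : K) :
    genericAut (ι := ι) σ (MvPolynomial.C x) = MvPolynomial.C (σ x) := by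
  have h1 : genericAut (ι := ι) σ (MvPolynomial.C x) = genericTranslate (fun A => (A⁻¹).1)
      (MvPolynomial.mapEquiv (GL ι K × ι × ι) σ (MvPolynomial.C x)) := rfl
  rw [h1, MvPolynomial.mapEquiv_apply, MvPolynomial.map_C]
  exact (genericTranslate _).commutes _

theorem mul_map_genericAut (σ : K ≃+* K) (A : GL ι K) :
    A.1.map MvPolynomial.C * (genericMatrix A).map (genericAut σ) = genericMatrix A := by
  have h : (genericMatrix A).map (genericAut σ) =
      (genericMatrix A).map (genericTranslate fun A => (A⁻¹).1) := by
    ext1 i j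
    simp [genericMatrix, genericAut]
  rw [h, map_genericTranslate_genericMatrix, ← Matrix.mul_assoc, ← Matrix.map_mul, A.mul_inv,
    Matrix.map_one _ (map_zero _) (map_one _), Matrix.one_mul]

/-- Specialising the variables to the identity matrix gives determinant 1. -/
theorem det_genericMatrix_ne_zero (A : GL ι K) : (genericMatrix A).det ≠ 0 := by
  intro h
  have h' := congrArg (MvPolynomial.eval fun p : GL ι K × ι × ι => (1 : Matrix ι ι K) p.2.1 p.2.2) h
  rw [RingHom.map_det, map_zero] at h'
  have : (MvPolynomial.eval fun p : GL ι K × ι × ι => (1 : Matrix ι ι K) p.2.1 p.2.2).mapMatrix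
      (genericMatrix A) = 1 := by
    ext1 i j
    simp [genericMatrix]
  simp [this] at h'

end GenericMatrix

open Cardinal in
/-- Every infinite field with an automorphism embeds into an algebraically closed one of the same
cardinality in which the equations `A * τ(Z) = Z` with `A` over the small field are solvable. -/
theorem exists_extension_solving {ι : Type} [Fintype ι] [DecidableEq ι] {K : Type*} [Field K]
    [Infinite K] (σ : K ≃+* K) :
    ∃ (L : Type _) (_ : Field L) (f : K →+* L) (τ : L ≃+* L), IsAlgClosed L ∧ #L ≤ #K ∧
      (∀ x, τ (f x) = f (σ x)) ∧
      ∀ A : GL ι K, ∃ Z : GL ι L, A.1.map f * Z.1.map τ = Z.1 := by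
  let R := MvPolynomial (GL ι K × ι × ι) K
  let Q := FractionRing R
  let L := AlgebraicClosure Q
  -- The extension to the algebraic closure is a choice; only its values on `R` matter.
  let τ : L ≃+* L := IsAlgClosure.equivOfEquiv L L
    (IsFractionRing.ringEquivOfRingEquiv (K := Q) (L := Q) (genericAut (ι := ι) σ))
  let g : R →+* L := (algebraMap Q L).comp (algebraMap R Q)
  have hg : Function.Injective g :=
    (algebraMap Q L).injective.comp (IsFractionRing.injective R Q)
  have hτ (x : R) : τ (g x) = g (genericAut σ x) := by
    simp only [τ, g, RingHom.comp_apply]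
    rw [IsAlgClosure.equivOfEquiv_algebraMap, IsFractionRing.ringEquivOfRingEquiv_algebraMap]
  refine ⟨L, inferInstance, g.comp MvPolynomial.C, τ, inferInstance, ?_, fun x => ?_, fun A => ?_⟩
  · have hK : ℵ₀ ≤ #K := aleph0_le_mk K
    have hM : #(Matrix ι ι K) ≤ #K := by
      have : #(Matrix ι ι K) = #(ι × ι → K) :=
        Cardinal.mk_congr (Equiv.curry ι ι K).symm
      rw [this, Cardinal.mk_arrow, Cardinal.mk_fintype (ι × ι),
        Cardinal.lift_natCast, Cardinal.lift_uzero]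
      exact_mod_cast Cardinal.power_nat_le (n := Fintype.card (ι × ι)) hK
    have hGL : #(GL ι K) ≤ #K := (Cardinal.mk_le_of_injective Units.val_injective).trans hM
    have hs : #(GL ι K × ι × ι) ≤ #K := by
      rw [Cardinal.mk_prod, Cardinal.lift_uzero, Cardinal.mk_fintype (ι × ι), Cardinal.lift_natCast]
      exact mul_le_of_le hK hGL (Cardinal.natCast_lt_aleph0.le.trans hK)
    have hR : #R ≤ #K := by
      have := MvPolynomial.cardinalMk_le_max (σ := GL ι K × ι × ι) (R := K)
      exact this.trans (max_le (max_le le_rfl hs) hK)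
    have hQ : #Q = #R := IsFractionRing.cardinalMk R Q
    calc #L ≤ max #Q ℵ₀ := Algebra.IsAlgebraic.cardinalMk_le_max Q L
      _ ≤ #K := max_le (hQ.trans_le hR) hK
  · simp only [RingHom.comp_apply]
    rw [hτ, genericAut_C]
  · have hdet : ((genericMatrix A).map g).det ≠ 0 := by
      have := RingHom.map_det g (genericMatrix A)
      rw [RingHom.mapMatrix_apply] at this
      rw [← this, ne_eq, map_eq_zero_iff g hg]
      exact det_genericMatrix_ne_zero A
    refine ⟨Matrix.GeneralLinearGroup.mkOfDetNeZero _ hdet, ?_⟩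
    change A.1.map (g.comp MvPolynomial.C) * ((genericMatrix A).map g).map τ =
      (genericMatrix A).map g
    have h1 : ((genericMatrix A).map g).map τ = ((genericMatrix A).map (genericAut σ)).map g := by
      ext1 i j
      exact hτ _
    have h2 : A.1.map (g.comp MvPolynomial.C) = (A.1.map MvPolynomial.C).map g := rfl
    rw [h1, h2, ← Matrix.map_mul, mul_map_genericAut]

/-! ### Direct limits of fields with automorphisms. -/

section Limit

variable {F : ℕ → Type*} [∀ n, Field (F n)]

/-- The transition maps of a sequence of field embeddings. -/
def natTransition (f : ∀ n, F n →+* F (n + 1)) (i j : ℕ) (h : i ≤ j) : F i →+* F j :=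
  Nat.leRec (motive := fun j _ => F i →+* F j) (RingHom.id _) (fun k _ g => (f k).comp g) h

theorem natTransition_self (f : ∀ n, F n →+* F (n + 1)) (i : ℕ) :
    natTransition f i i le_rfl = RingHom.id _ :=
  Nat.leRec_self _ _

theorem natTransition_succ (f : ∀ n, F n →+* F (n + 1)) {i j : ℕ} (h : i ≤ j) :
    natTransition f i (j + 1) (Nat.le_succ_of_le h) = (f j).comp (natTransition f i j h) :=
  Nat.leRec_succ _ _ _

theorem natTransition_trans (f : ∀ n, F n →+* F (n + 1)) {i j k : ℕ} (hij : i ≤ j) (hjk : j ≤ k)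
    (x : F i) : natTransition f j k hjk (natTransition f i j hij x) =
      natTransition f i k (hij.trans hjk) x := by
  induction k, hjk using Nat.le_induction with
  | base => simp [natTransition_self]
  | succ k hjk ih =>
    rw [natTransition_succ f hjk, natTransition_succ f (hij.trans hjk), RingHom.comp_apply, ih]
    rfl

theorem natTransition_comm (f : ∀ n, F n →+* F (n + 1)) (σ : ∀ n, F n →+* F n)
    (hσ : ∀ n x, σ (n + 1) (f n x) = f n (σ n x)) {i j : ℕ} (h : i ≤ j) (x : F i) :
    natTransition f i j h (σ i x) = σ j (natTransition f i j h x) := by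
  induction j, h using Nat.le_induction with
  | base => simp [natTransition_self]
  | succ j h ih => rw [natTransition_succ f h, RingHom.comp_apply, ih, RingHom.comp_apply, hσ]

instance natTransition_directedSystem (f : ∀ n, F n →+* F (n + 1)) :
    DirectedSystem F (fun i j h => natTransition f i j h) where
  map_self i x := by simp [natTransition_self]
  map_map i j k hij hjk x := natTransition_trans f _ _ x

/-- The direct limit of a sequence of fields with automorphisms. -/
theorem exists_field_limit.{u} {F : ℕ → Type u} [∀ n, Field (F n)] (f : ∀ n, F n →+* F (n + 1))
    (σ : ∀ n, F n ≃+* F n) (hσ : ∀ n x, σ (n + 1) (f n x) = f n (σ n x)) :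
    ∃ (L : Type u) (_ : Field L) (e : ∀ n, F n →+* L) (τ : L ≃+* L),
      (∀ n x, e (n + 1) (f n x) = e n x) ∧ (∀ n x, τ (e n x) = e n (σ n x)) ∧
      ∀ y, ∃ n x, e n x = y := by
  let t := natTransition f
  let L := DirectLimit F t
  let e (n : ℕ) : F n →+* L :=
    { toFun x := ⟦⟨n, x⟩⟧
      map_one' := (DirectLimit.one_def n).symm
      map_zero' := (DirectLimit.zero_def n).symm
      map_mul' x y := (DirectLimit.mul_def n x y).symm
      map_add' x y := (DirectLimit.add_def n x y).symm }
  have hσ' (n x) : (σ (n + 1)).symm (f n x) = f n ((σ n).symm x) := by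
    rw [RingEquiv.symm_apply_eq, hσ, RingEquiv.apply_symm_apply]
  have he (y : L) : ∃ n x, e n x = y := by
    obtain ⟨n, x, rfl⟩ := DirectLimit.exists_eq_mk t y
    exact ⟨n, x, rfl⟩
  let s : L → L := DirectLimit.map t t (fun n => σ n)
    fun i j h x => natTransition_comm f (fun n => (σ n : F n →+* F n)) hσ h x
  let s' : L → L := DirectLimit.map t t (fun n => (σ n).symm)
    fun i j h x => natTransition_comm f (fun n => ((σ n).symm : F n →+* F n)) hσ' h x
  have hs (n x) : s (e n x) = e n (σ n x) := rfl
  have hs' (n x) : s' (e n x) = e n ((σ n).symm x) := rfl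
  have he₂ (y z : L) : ∃ n x w, y = e n x ∧ z = e n w := DirectLimit.exists_eq_mk₂ t y z
  let τ : L ≃+* L :=
    { toFun := s
      invFun := s'
      left_inv y := by
        obtain ⟨n, x, rfl⟩ := he y
        rw [hs, hs', RingEquiv.symm_apply_apply]
      right_inv y := by
        obtain ⟨n, x, rfl⟩ := he y
        rw [hs', hs, RingEquiv.apply_symm_apply]
      map_mul' y z := by
        obtain ⟨n, x, w, rfl, rfl⟩ := he₂ y z
        rw [← map_mul, hs, hs, hs, map_mul, map_mul]
      map_add' y z := by
        obtain ⟨n, x, w, rfl, rfl⟩ := he₂ y z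
        rw [← map_add, hs, hs, hs, map_add, map_add] }
  refine ⟨L, inferInstance, e, τ, fun n x => ?_, hs, he⟩
  have h := DirectLimit.mk_apply (f := t) n (n + 1) x n.le_succ
  have h2 : t n (n + 1) n.le_succ = f n := by
    have := natTransition_succ f (le_refl n)
    rwa [natTransition_self] at this
  rw [h2] at h
  exact h

end Limit

/-! ### Normal form of alternating forms. -/

open Module in
/-- A symplectic basis, up to linear independence. -/
theorem exists_symplectic_family {k : Type*} [Field k] (m : ℕ) :
    ∀ {V : Type*} [AddCommGroup V] [Module k V] [FiniteDimensional k V]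
      (B : LinearMap.BilinForm k V), B.IsAlt → (∀ x, (∀ y, B x y = 0) → x = 0) →
      2 * m ≤ finrank k V →
      ∃ e : Fin 2 → Fin m → V, (∀ a i j, B (e a i) (e a j) = 0) ∧
        ∀ i j, B (e 0 i) (e 1 j) = if i = j then 1 else 0 := by
  induction m with
  | zero => exact fun B _ _ _ => ⟨fun _ => Fin.elim0, fun _ i => i.elim0, fun i => i.elim0⟩
  | succ m ih =>
    intro V _ _ _ B halt hB hV
    have : Nontrivial V := finrank_pos_iff.mp (show 0 < finrank k V by omega)
    obtain ⟨v, hv⟩ := exists_ne (0 : V)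
    obtain ⟨w₀, hw₀⟩ : ∃ w, B v w ≠ 0 := by
      by_contra! h
      exact hv (hB v h)
    obtain ⟨w, hw⟩ : ∃ w, B v w = 1 := ⟨(B v w₀)⁻¹ • w₀, by simp [hw₀]⟩
    have hwv : B w v = -1 := by rw [← halt.neg_eq v w, hw]
    -- The kernel `U` is the orthogonal complement of the hyperbolic plane spanned by `v` and `w`,
    -- of codimension at most 2.
    let p : V →ₗ[k] k × k := (B v).prod (B w)
    let U := LinearMap.ker p
    have hU (x : V) : x ∈ U ↔ B v x = 0 ∧ B w x = 0 := by
      simp [U, p, LinearMap.mem_ker]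
    have hdim : 2 * m ≤ finrank k U := by
      have h1 := LinearMap.finrank_range_add_finrank_ker p
      have h2 : finrank k (LinearMap.range p) ≤ 2 := by
        simpa using Submodule.finrank_le (LinearMap.range p)
      change finrank k (LinearMap.range p) + finrank k U = finrank k V at h1
      omega
    have hres : ∀ x : U, (∀ y : U, B.restrict U x y = 0) → x = 0 := by
      rintro ⟨x, hx⟩ h
      rw [hU] at hx
      have hxv : B x v = 0 := by rw [← halt.neg_eq v x, hx.1, neg_zero]
      have hxw : B x w = 0 := by rw [← halt.neg_eq w x, hx.2, neg_zero]
      rw [Subtype.ext_iff]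
      refine hB x fun y => ?_
      -- This is the projection of `y` to `U`; pairing with `x` does not see the correction, as `x`
      -- is orthogonal to `v` and `w`.
      have := h ⟨y + B w y • v - B v y • w, by
        rw [hU]; simp [hw, hwv, halt.self_eq_zero]⟩
      simpa [hxv, hxw] using this
    obtain ⟨e, he₁, he₂⟩ := ih (B.restrict U) (fun x => halt x) hres hdim
    have hvU (a i) : B v (e a i) = 0 := ((hU _).1 (e a i).2).1
    have hwU (a i) : B w (e a i) = 0 := ((hU _).1 (e a i).2).2
    have hUv (a i) : B (e a i) v = 0 := by rw [← halt.neg_eq v, hvU, neg_zero]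
    have hUw (a i) : B (e a i) w = 0 := by rw [← halt.neg_eq w, hwU, neg_zero]
    refine ⟨fun a => Fin.cons (![v, w] a) fun i => (e a i : V), fun a i j => ?_, fun i j => ?_⟩
    · have h₀ (j) : B (![v, w] a) (e a j) = 0 := by
        fin_cases a
        exacts [hvU _ j, hwU _ j]
      have h₁ (j) : B (e a j) (![v, w] a) = 0 := by
        fin_cases a
        exacts [hUv _ j, hUw _ j]
      refine Fin.cases ?_ (fun i => ?_) i <;> refine Fin.cases ?_ (fun j => ?_) j
      exacts [halt _, h₀ j, h₁ i, he₁ a i j]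
    · refine Fin.cases ?_ (fun i => ?_) i <;> refine Fin.cases ?_ (fun j => ?_) j
      · simpa using hw
      · simpa [(Fin.succ_ne_zero _).symm] using hvU 1 j
      · simpa using hUw 0 i
      · simpa using he₂ i j

theorem symplecticForm_apply {m : ℕ} {k : Type*} [Field k] (p q : Fin 2 × Fin m) :
    symplecticForm m k p q =
      if p.2 = q.2 then !![0, 1; -1, 0] p.1 q.1 else 0 :=
  Matrix.blockDiagonal_apply _ _ _

theorem det_symplecticForm (m : ℕ) (k : Type*) [Field k] : (symplecticForm m k).det = 1 := by
  simp [symplecticForm, Matrix.det_blockDiagonal, Matrix.det_fin_two]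

/-- Every invertible alternating matrix is congruent to the standard one. -/
theorem exists_mul_mul_transpose_eq_symplecticForm {m : ℕ} {k : Type*} [Field k]
    (M : Matrix (Fin 2 × Fin m) (Fin 2 × Fin m) k) (hM : M.det ≠ 0)
    (halt : ∀ v, v ⬝ᵥ M *ᵥ v = 0) :
    ∃ C : GL (Fin 2 × Fin m) k, C.1 * M * C.1ᵀ = symplecticForm m k := by
  have hB (v w) : Matrix.toBilin' M v w = v ⬝ᵥ M *ᵥ w := Matrix.toBilin'_apply' M v w
  have hIsAlt : (Matrix.toBilin' M).IsAlt := fun v => (hB v v).trans (halt v)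
  obtain ⟨e, he₁, he₂⟩ := exists_symplectic_family m (Matrix.toBilin' M) hIsAlt
    (fun x hx => by
      by_contra h
      refine hM (Matrix.exists_vecMul_eq_zero_iff.mp ⟨x, h, ?_⟩)
      refine dotProduct_eq_zero _ fun y => ?_
      rw [← Matrix.dotProduct_mulVec, ← hB, hx])
    (by simp)
  let C : Matrix (Fin 2 × Fin m) (Fin 2 × Fin m) k := Matrix.of fun p => e p.1 p.2
  have hC : C * M * Cᵀ = symplecticForm m k := by
    ext1 ⟨a, i⟩ ⟨b, j⟩
    have h1 : (C * M * Cᵀ) (a, i) (b, j) = Matrix.toBilin' M (e a i) (e b j) := by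
      rw [hB, Matrix.mul_assoc]
      simp [Matrix.mul_apply, dotProduct, Matrix.mulVec, C]
    have h3 : Matrix.toBilin' M (e 1 i) (e 0 j) = if i = j then -1 else 0 := by
      rw [← hIsAlt.neg_eq, he₂]
      simp only [eq_comm (a := j)]
      split_ifs <;> simp
    rw [h1, symplecticForm_apply]
    fin_cases a <;> fin_cases b <;> simp [he₁, he₂, h3]
  -- Linear independence of the family comes for free from the determinant of `hC`.
  have hdet : C.det ≠ 0 := by
    intro h
    have := congrArg Matrix.det hC
    simp [h, det_symplecticForm] at this
  exact ⟨Matrix.GeneralLinearGroup.mkOfDetNeZero C hdet, hC⟩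

/-- The field automorphism `σ` has the property that every invertible matrix over `K` of the given
size is of the form `Z * σ(Z)⁻¹`. -/
def SolvesGL (ι : Type*) [Fintype ι] [DecidableEq ι] {K : Type*} [Field K] (σ : K ≃+* K) : Prop :=
  ∀ A : GL ι K, ∃ Z : GL ι K, A.1 * Z.1.map σ = Z.1

/-! ### The tower of extensions and its limit. -/

section Tower

/-- A field of characteristic zero with an automorphism. -/
structure DifferenceField.{u} where
  carrier : Type u
  [field : Field carrier]
  [charZero : CharZero carrier]
  aut : carrier ≃+* carrier

attribute [instance] DifferenceField.field DifferenceField.charZero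

/-- A finite family in a direct limit over `ℕ` comes from a single stage. -/
theorem exists_lift_of_finite {L : Type*} {F : ℕ → Type*} (e : ∀ n, F n → L)
    (mono : ∀ i j, i ≤ j → ∀ x, ∃ y, e j y = e i x) (he : ∀ y, ∃ n x, e n x = y)
    {s : Type*} [Finite s] (g : s → L) : ∃ n, ∃ h : s → F n, ∀ i, e n (h i) = g i := by
  choose n x hx using fun i => he (g i)
  obtain ⟨N, hN⟩ := (Set.finite_range n).bddAbove
  choose y hy using fun i => mono (n i) N (hN ⟨i, rfl⟩) (x i)
  exact ⟨N, y, fun i => (hy i).trans (hx i)⟩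

open Cardinal Polynomial in
/-- Every field of characteristic zero embeds into an algebraically closed field of the same
cardinality that has an automorphism `σ` such that all invertible matrices are `Z * σ(Z)⁻¹`. -/
theorem exists_isAlgClosed_solvesGL.{u} (ι : Type) [Fintype ι] [DecidableEq ι] (K : Type u)
    [Field K] [CharZero K] :
    ∃ (L : Type u) (_ : Field L) (_ : K →+* L) (τ : L ≃+* L), IsAlgClosed L ∧ #L ≤ #K ∧
      SolvesGL ι τ := by
  have step (D : DifferenceField.{u}) : ∃ (E : DifferenceField.{u}) (f : D.carrier →+* E.carrier),
      IsAlgClosed E.carrier ∧ #E.carrier ≤ #D.carrier ∧ (∀ x, E.aut (f x) = f (D.aut x)) ∧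
      ∀ A : GL ι D.carrier, ∃ Z : GL ι E.carrier, A.1.map f * Z.1.map E.aut = Z.1 := by
    have : Infinite D.carrier := CharZero.infinite _
    obtain ⟨L, _, f, τ, h⟩ := exists_extension_solving (ι := ι) D.aut
    have : CharZero L := charZero_of_injective_ringHom f.injective
    exact ⟨⟨L, τ⟩, f, h⟩
  choose next f hclosed hcard hcomm hsolve using step
  let D (n : ℕ) : DifferenceField.{u} := next^[n] ⟨K, RingEquiv.refl K⟩
  have hD (n) : D (n + 1) = next (D n) := Function.iterate_succ_apply' _ _ _
  have hf (n) : ∃ f : (D n).carrier →+* (D (n + 1)).carrier,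
      IsAlgClosed (D (n + 1)).carrier ∧ #(D (n + 1)).carrier ≤ #(D n).carrier ∧
      (∀ x, (D (n + 1)).aut (f x) = f ((D n).aut x)) ∧
      ∀ A : GL ι (D n).carrier, ∃ Z : GL ι (D (n + 1)).carrier,
        A.1.map f * Z.1.map (D (n + 1)).aut = Z.1 := by
    rw [hD]
    exact ⟨f _, hclosed _, hcard _, hcomm _, hsolve _⟩
  obtain ⟨base, hbase⟩ : ∃ _ : K →+* (D 0).carrier, #(D 0).carrier = #K := ⟨RingHom.id K, rfl⟩
  clear_value D
  choose g hclosed' hcard' hcomm' hsolve' using hf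
  obtain ⟨L, _, e, τ, he, hτ, hsurj⟩ := exists_field_limit (F := fun n => (D n).carrier) g
    (fun n => (D n).aut) hcomm'
  have hmono (i j : ℕ) (hij : i ≤ j) (x : (D i).carrier) : ∃ y, e j y = e i x := by
    induction j, hij using Nat.le_induction with
    | base => exact ⟨x, rfl⟩
    | succ j _ ih =>
      obtain ⟨y, hy⟩ := ih
      exact ⟨g j y, (he j y).trans hy⟩
  have he' (n : ℕ) : (e (n + 1)).comp (g n) = e n := RingHom.ext (he n)
  refine ⟨L, inferInstance, (e 0).comp base, τ, ?_, ?_, fun A => ?_⟩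
  · refine IsAlgClosed.of_exists_root L fun p _ hp => ?_
    obtain ⟨n, c, hc⟩ := exists_lift_of_finite (fun n => e n) hmono hsurj
      fun i : Fin (p.natDegree + 1) => p.coeff i
    let q : (D n).carrier[X] := ∑ i, C (c i) * X ^ (i : ℕ)
    have hq : q.map (e n) = p := by
      conv_rhs => rw [p.as_sum_range_C_mul_X_pow, Finset.sum_range]
      simp [q, Polynomial.map_sum, hc]
    have := hclosed' n
    have hqdeg : q.degree ≠ 0 := by
      rw [← degree_map q (e n), hq]
      exact (degree_pos_of_irreducible hp).ne'
    -- The root is taken one stage later, since stage 0 need not be algebraically closed.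
    obtain ⟨x, hx⟩ := IsAlgClosed.exists_eval₂_eq_zero_of_injective (g n) (g n).injective q hqdeg
    refine ⟨e (n + 1) x, ?_⟩
    rw [← hq, eval_map, ← he' n, ← hom_eval₂, hx, map_zero]
  · have hle (n : ℕ) : #(D n).carrier ≤ #K := by
      induction n with
      | zero => exact hbase.le
      | succ n ih => exact (hcard' n).trans ih
    have : Infinite K := CharZero.infinite K
    have hsig : Function.Surjective fun x : Σ n, (D n).carrier => e x.1 x.2 := fun y =>
      let ⟨n, x, h⟩ := hsurj y
      ⟨⟨n, x⟩, h⟩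
    calc #L ≤ #(Σ n, (D n).carrier) := Cardinal.mk_le_of_surjective hsig
      _ = Cardinal.sum fun n => #(D n).carrier := Cardinal.mk_sigma _
      _ ≤ Cardinal.sum fun _ : ℕ => #K := Cardinal.sum_le_sum _ _ hle
      _ = ℵ₀ * #K := by simp
      _ ≤ #K := Cardinal.mul_le_of_le (aleph0_le_mk K) (aleph0_le_mk K) le_rfl
  · obtain ⟨n, c, hc⟩ := exists_lift_of_finite (fun n => e n) hmono hsurj fun p : ι × ι => A.1 p.1 p.2
    let A₀ : Matrix ι ι (D n).carrier := Matrix.of fun i j => c (i, j)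
    have hA₀ : A₀.map (e n) = A.1 := by
      ext1 i j
      exact hc (i, j)
    have hdet : A₀.det ≠ 0 := by
      intro h
      have h' := RingHom.map_det (e n) A₀
      rw [RingHom.mapMatrix_apply, hA₀, h, map_zero] at h'
      exact ((Matrix.isUnit_iff_isUnit_det _).mp A.isUnit).ne_zero h'.symm
    obtain ⟨Z, hZ⟩ := hsolve' n (Matrix.GeneralLinearGroup.mkOfDetNeZero A₀ hdet)
    refine ⟨Matrix.GeneralLinearGroup.map (e (n + 1)) Z, ?_⟩
    change A.1 * (Z.1.map (e (n + 1))).map τ = Z.1.map (e (n + 1))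
    have h1 : (Z.1.map (e (n + 1))).map τ = (Z.1.map (D (n + 1)).aut).map (e (n + 1)) := by
      ext1 i j
      exact hτ _ _
    have h2 : A.1 = (A₀.map (g n)).map (e (n + 1)) := by
      rw [← hA₀, ← he' n]
      rfl
    rw [h1, h2, ← Matrix.map_mul]
    exact congrArg (fun M => M.map (e (n + 1))) hZ

end Tower

/-! ### Transport of the automorphism to `F`. -/

theorem SolvesGL.congr {ι : Type*} [Fintype ι] [DecidableEq ι] {K L : Type*} [Field K] [Field L]
    {τ : L ≃+* L} (h : SolvesGL ι τ) (e : K ≃+* L) : SolvesGL ι ((e.trans τ).trans e.symm) := by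
  intro A
  obtain ⟨Z, hZ⟩ := h (Matrix.GeneralLinearGroup.map (e : K →+* L) A)
  refine ⟨Matrix.GeneralLinearGroup.map (e.symm : L →+* K) Z, ?_⟩
  have hA : A.1 = (A.1.map e).map e.symm := by
    ext1 i j
    simp
  have hZ' : (Z.1.map e.symm).map ((e.trans τ).trans e.symm) = (Z.1.map τ).map e.symm := by
    ext1 i j
    simp
  change A.1 * (Z.1.map e.symm).map ((e.trans τ).trans e.symm) = Z.1.map e.symm
  rw [hZ', hA, ← Matrix.map_mul]
  exact congrArg (fun M => M.map e.symm) hZ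

open Cardinal in
/-- Over an algebraically closed field of characteristic zero and infinite transcendence degree the
cardinality is the transcendence degree. -/
theorem mk_eq_trdeg_of_aleph0_le {F : Type*} [Field F] [IsAlgClosed F] [CharZero F]
    (hF : ℵ₀ ≤ Algebra.trdeg ℚ F) : #F = Algebra.trdeg ℚ F := by
  obtain ⟨s, hs⟩ := exists_isTranscendenceBasis ℚ F
  refine le_antisymm ?_ ?_
  · have h := IsAlgClosed.cardinal_le_max_transcendence_basis _ hs
    rw [hs.cardinalMk_eq_trdeg] at h
    simpa [hF] using h
  · rw [← hs.cardinalMk_eq_trdeg]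
    exact Cardinal.mk_set_le s

open Cardinal in
theorem exists_solvesGL (ι : Type) [Fintype ι] [DecidableEq ι] {F : Type*} [Field F]
    [IsAlgClosed F] [CharZero F] (hF : ℵ₀ ≤ Algebra.trdeg ℚ F) :
    ∃ φ : F ≃+* F, SolvesGL ι φ := by
  obtain ⟨L, _, f, τ, _, hcard, hτ⟩ := exists_isAlgClosed_solvesGL ι F
  have : CharZero L := charZero_of_injective_ringHom f.injective
  have hle : Algebra.trdeg ℚ F ≤ Algebra.trdeg ℚ L :=
    trdeg_le_of_injective f.toRatAlgHom f.injective
  have heq : Algebra.trdeg ℚ F = Algebra.trdeg ℚ L := by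
    refine hle.antisymm ?_
    rw [← mk_eq_trdeg_of_aleph0_le hF, ← mk_eq_trdeg_of_aleph0_le (hF.trans hle)]
    exact hcard
  obtain ⟨s, hs⟩ := exists_isTranscendenceBasis ℚ F
  obtain ⟨t, ht⟩ := exists_isTranscendenceBasis ℚ L
  rw [← hs.cardinalMk_eq_trdeg, ← ht.cardinalMk_eq_trdeg] at heq
  obtain ⟨b⟩ := Cardinal.eq.mp heq
  exact ⟨_, hτ.congr (IsAlgClosed.equivOfTranscendenceBasis _ _ b hs ht)⟩

/-! ### Correction to symplectic solutions. -/

theorem symplecticForm_map {m : ℕ} {k K : Type*} [Field k] [Field K] (f : k →+* K) :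
    (symplecticForm m k).map f = symplecticForm m K := by
  ext1 ⟨a, i⟩ ⟨b, j⟩
  rw [Matrix.map_apply, symplecticForm_apply, symplecticForm_apply]
  fin_cases a <;> fin_cases b <;> by_cases h : i = j <;> simp [h]

theorem symplecticForm_transpose (m : ℕ) (k : Type*) [Field k] :
    (symplecticForm m k)ᵀ = -symplecticForm m k := by
  ext1 ⟨a, i⟩ ⟨b, j⟩
  rw [Matrix.transpose_apply, Matrix.neg_apply, symplecticForm_apply, symplecticForm_apply]
  fin_cases a <;> fin_cases b <;> by_cases h : i = j <;> simp [h, eq_comm]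

/-- A skew-symmetric matrix over a field of characteristic zero is alternating. -/
theorem dotProduct_mulVec_self_of_transpose_eq_neg {ι k : Type*} [Fintype ι] [Field k] [CharZero k]
    {M : Matrix ι ι k} (hM : Mᵀ = -M) (v : ι → k) : v ⬝ᵥ M *ᵥ v = 0 := by
  have h : v ⬝ᵥ M *ᵥ v = -(v ⬝ᵥ M *ᵥ v) := by
    conv_lhs => rw [dotProduct_comm, ← Matrix.vecMul_transpose, hM, ← Matrix.dotProduct_mulVec]
    simp [Matrix.neg_mulVec]
  exact self_eq_neg.mp h

/-- A solution of `A * φ(Z) = Z` in the general linear group can be corrected by a matrix over the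
fixed field of `φ` to a symplectic one when `A` is symplectic. -/
theorem exists_symplectic_solution {m : ℕ} {F : Type*} [Field F] [CharZero F] {φ : F ≃+* F}
    {A : GL (Fin 2 × Fin m) F} (hA : A ∈ Sp m F) {Z : GL (Fin 2 × Fin m) F}
    (hZ : A.1 * Z.1.map φ = Z.1) : ∃ W ∈ Sp m F, A.1 * W.1.map φ = W.1 := by
  let Ω := symplecticForm m F
  have hA' : A.1 * Ω * A.1ᵀ = Ω := hA
  let k := (φ : F →+* F).eqLocusField (RingHom.id F)
  let ψ := Matrix.GeneralLinearGroup.map (n := Fin 2 × Fin m) (φ : F →+* F)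
  let B : Matrix (Fin 2 × Fin m) (Fin 2 × Fin m) F := (Z⁻¹).1 * Ω * (Z⁻¹).1ᵀ
  have hZ' : A * ψ Z = Z := Units.ext hZ
  have hφZ : ψ Z⁻¹ = Z⁻¹ * A := by
    rw [map_inv, inv_eq_iff_eq_inv, mul_inv_rev, inv_inv, eq_inv_mul_iff_mul_eq]
    exact hZ'
  have hφZ' : (Z⁻¹).1.map φ = (Z⁻¹).1 * A.1 := congrArg Units.val hφZ
  have hΩ : Ω.map φ = Ω := symplecticForm_map (φ : F →+* F)
  -- Since `φ(Z⁻¹) = Z⁻¹ A`, applying `φ` replaces `Ω` by `A Ω Aᵀ = Ω`.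
  have hB : B.map φ = B := by
    have ht : (Z⁻¹).1ᵀ.map φ = A.1ᵀ * (Z⁻¹).1ᵀ := by
      rw [Matrix.transpose_map, hφZ', Matrix.transpose_mul]
    simp only [B, Matrix.map_mul, hΩ, hφZ', ht]
    calc _ = (Z⁻¹).1 * (A.1 * Ω * A.1ᵀ) * (Z⁻¹).1ᵀ := by simp only [Matrix.mul_assoc]
      _ = _ := by rw [hA']
  have hBk (i j) : B i j ∈ k := congrFun (congrFun hB i) j
  let B₀ : Matrix (Fin 2 × Fin m) (Fin 2 × Fin m) k := Matrix.of fun i j => ⟨B i j, hBk i j⟩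
  have hB₀ : B₀.map k.subtype = B := rfl
  have hBt : Bᵀ = -B := by
    simp only [B, Matrix.transpose_mul, Matrix.transpose_transpose]
    rw [symplecticForm_transpose, Matrix.neg_mul, Matrix.mul_neg, Matrix.mul_assoc]
  have hB₀t : B₀ᵀ = -B₀ := by
    ext1 i j
    exact Subtype.ext (congrFun (congrFun hBt i) j)
  have hdet : B₀.det ≠ 0 := by
    intro h
    have h' := RingHom.map_det k.subtype B₀
    rw [RingHom.mapMatrix_apply, hB₀, h, map_zero] at h'
    have hu := (Matrix.isUnit_iff_isUnit_det _).mp (Z⁻¹).isUnit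
    simp only [B, Matrix.det_mul, Matrix.det_transpose, Ω, det_symplecticForm, mul_one] at h'
    exact (hu.mul hu).ne_zero h'.symm
  obtain ⟨C₀, hC₀⟩ := exists_mul_mul_transpose_eq_symplecticForm B₀ hdet
    (dotProduct_mulVec_self_of_transpose_eq_neg hB₀t)
  let C := Matrix.GeneralLinearGroup.map k.subtype C₀
  have hC : C.1 * B * C.1ᵀ = Ω := by
    have := congrArg (fun M => M.map k.subtype) hC₀
    simp only [Matrix.map_mul, hB₀, symplecticForm_map, Matrix.transpose_map] at this
    exact this
  have hCφ : ψ C = C := by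
    ext i j
    exact (C₀.1 i j).2
  -- `C * Z⁻¹` preserves `Ω` by `hC`, and `C` is fixed by `φ`, so the equation survives the
  -- correction.
  refine ⟨Z * C⁻¹, ?_, ?_⟩
  · rw [← inv_mem_iff, mul_inv_rev, inv_inv]
    change (C * Z⁻¹).1 * Ω * (C * Z⁻¹).1ᵀ = Ω
    refine Eq.trans ?_ hC
    simp only [B, Units.val_mul, Matrix.transpose_mul, Matrix.mul_assoc]
  · have : A * ψ (Z * C⁻¹) = Z * C⁻¹ := by
      rw [map_mul, map_inv, hCφ, ← mul_assoc, hZ']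
    exact congrArg Units.val this

theorem theorem4 {F : Type*} [Field F] [IsAlgClosed F] [CharZero F]
    (hF : Cardinal.aleph0 ≤ Algebra.trdeg ℚ F) (m : ℕ) (hm : 1 ≤ m) :
    ∃ φ : F ≃+* F, reidemeisterNumber (Sp.inducedAut m φ) = 1 := by
  obtain ⟨φ, hφ⟩ := exists_solvesGL (Fin 2 × Fin m) hF
  refine ⟨φ, ?_⟩
  have key (A : Sp m F) : IsTwistedConj (Sp.inducedAut m φ) A 1 := by
    obtain ⟨Z, hZ⟩ := hφ A.1
    obtain ⟨W, hW, h⟩ := exists_symplectic_solution A.2 hZ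
    refine ⟨⟨W, hW⟩, ?_⟩
    rw [mul_one, eq_mul_inv_iff_mul_eq]
    exact Subtype.ext (Units.ext h)
  rw [reidemeisterNumber, ENat.card_eq_one_iff_unique, unique_iff_subsingleton_and_nonempty]
  refine ⟨⟨fun x y => ?_⟩, ⟨Quotient.mk _ 1⟩⟩
  induction x using Quotient.ind
  induction y using Quotient.ind
  exact (Quotient.sound (s := twistedConjSetoid _) (key _)).trans
    (Quotient.sound (s := twistedConjSetoid _) (key _)).symm
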